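/- Let $n,k\ge 0$ and $d\ge 1$ be integers, and let $\mathbb{TP}^n=\mathbb{R}^{n+1}/\mathbb{R}(1,\dots,1)$ be tropical projective space. Let $L\subset\mathbb{TP}^n$ be a linear subspace of dimension $d$, and let $M_L$ be a real $d\times(n+1)$ matrix whose rows represent generators of $L$. Let $V_L=(v_1,\dots,v_{n+1})$ be the configuration of points in $\mathbb{R}^d$ given by the columns of $M_L$. Suppose that $L$ is generic, i.e. that $V_L$ is in general position: no $d+1$ of the points $v_1,\dots,v_{n+1}$ (counted with multiplicity) lie in an affine subspace of $\mathbb{R}^d$ of dimension $d-1$. Let $S^k(L)\subset\mathbb{TP}^n$ be the $k$-th tropical secant variety of $L$, that is, the set of classes of the vectors $y_0\oplus\cdots\oplus y_k$, where $y_0,\dots,y_k\in\mathbb{R}^{n+1}$ represent points of $L$ and $\oplus$ is the coordinatewise minimum. Then $S^k(L)$ is a polyhedral complex of dimension $$\min\bigl((k+1)(d+1)-1,\;n\bigr);$$ that is, $S^k(L)$ is the union of the cells of some finite polyhedral complex in $\mathbb{TP}^n$, and in every such complex the largest dimension of a cell is this number. -/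

import Mathlib

/-- Tropical projective space `𝕋ℙⁿ = ℝⁿ⁺¹ / ℝ(1, …, 1)`. -/
abbrev TropProj (n : ℕ) : Type :=
  (Fin (n + 1) → ℝ) ⧸ Submodule.span ℝ {(fun _ => 1 : Fin (n + 1) → ℝ)}

/-- The class in `𝕋ℙⁿ` of a vector of `ℝⁿ⁺¹`. -/
def TropProj.mk {n : ℕ} (x : Fin (n + 1) → ℝ) : TropProj n :=
  Submodule.Quotient.mk x

/-- The tropical sum `y₀ ⊕ ⋯ ⊕ y_k` of `k + 1` vectors: their coordinatewise minimum. -/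
noncomputable def tropSum {n k : ℕ} (y : Fin (k + 1) → Fin (n + 1) → ℝ) : Fin (n + 1) → ℝ :=
  fun i => Finset.univ.inf' Finset.univ_nonempty fun j => y j i

/-- The `k`-th tropical secant variety of a linear subspace `L` of `𝕋ℙⁿ`: the classes of all
tropical sums of `k + 1` vectors of `ℝⁿ⁺¹` that represent points of `L`.
(All representatives are allowed: a tropical sum depends on them.) -/
def tropSecant {n : ℕ} (k : ℕ) (L : Submodule ℝ (TropProj n)) : Set (TropProj n) :=
  {p | ∃ y : Fin (k + 1) → Fin (n + 1) → ℝ,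
    (∀ j, TropProj.mk (y j) ∈ L) ∧ p = TropProj.mk (tropSum y)}

/-- A point configuration in `ℝᵈ` is in general position if no `d + 1` of its points lie in an
affine subspace of dimension `d - 1`. The points are counted with their indices. -/
def InGeneralPosition {ι : Type*} {d : ℕ} (v : ι → Fin d → ℝ) : Prop :=
  ∀ s : Finset ι, s.card = d + 1 → ∀ A : AffineSubspace ℝ (Fin d → ℝ),
    Module.finrank ℝ A.direction + 1 = d → ¬ ∀ i ∈ s, v i ∈ A

section Polyhedra

variable {E : Type*} [AddCommGroup E] [Module ℝ E]

/-- A polyhedron: the solution set of finitely many weak linear inequalities. -/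
def IsPolyhedron (P : Set E) : Prop :=
  ∃ (m : ℕ) (φ : Fin m → E →ₗ[ℝ] ℝ) (b : Fin m → ℝ), P = {x | ∀ i, φ i x ≤ b i}

/-- `F` is a face of `P`: it is cut out of `P` by equality in a linear inequality that is valid
on `P`. The empty set and `P` itself are faces of `P`. -/
def IsFace (P F : Set E) : Prop :=
  ∃ (φ : E →ₗ[ℝ] ℝ) (c : ℝ), (∀ x ∈ P, φ x ≤ c) ∧ F = {x ∈ P | φ x = c}

end Polyhedra

/-- A finite polyhedral complex in a real vector space, given by its nonempty cells. -/
structure PolyhedralComplex (E : Type*) [AddCommGroup E] [Module ℝ E] where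
  cells : Set (Set E)
  finite : cells.Finite
  nonempty : ∀ P ∈ cells, P.Nonempty
  polyhedron : ∀ P ∈ cells, IsPolyhedron P
  face_mem : ∀ P ∈ cells, ∀ F : Set E, IsFace P F → F.Nonempty → F ∈ cells
  inter_face : ∀ P ∈ cells, ∀ Q ∈ cells, IsFace P (P ∩ Q)

namespace PolyhedralComplex

variable {E : Type*} [AddCommGroup E] [Module ℝ E]

/-- The union of all cells. -/
def support (K : PolyhedralComplex E) : Set E := ⋃₀ K.cells

/-- `D` is the dimension of the complex: the largest dimension of a cell, where the dimension of
a cell is that of its affine span. -/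
def HasDim (K : PolyhedralComplex E) (D : ℕ) : Prop :=
  IsGreatest {m | ∃ P ∈ K.cells, m = Module.finrank ℝ (vectorSpan ℝ P)} D

end PolyhedralComplex

/-! A vector represents a point of `L` iff it lists the values of an affine function at the points
`v i`. A tropical sum is thus the minimum of `k + 1` affine functions read at the `v i`. Fixing
which function `I i` wins at each `v i` gives a polyhedron `minRegion v I` on which the sum is the
linear map `selectEval v I`. So the secant variety is a finite union of linear images of polyhedra,
and a hyperplane arrangement subdivides it into a complex.

Upper bound: each linear map into `TropProj n` kills the common additive constant. Lower bound: a
generic affine function orders the points; cutting them into consecutive blocks of `d + 1` gives an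
`I` with full-dimensional region, and general position gives `selectEval v I` maximal rank. Any
complex with this support has the same dimension, because a convex set covered by finitely many
affine subspaces lies in one of them (`Convex.exists_subset_of_subset_iUnion_affineSubspace`). -/

/-- Finitely many lower bounds and finitely many upper bounds on a real number are compatible as
soon as they are pairwise compatible. -/
theorem exists_between_of_finite {ι κ : Type*} [Finite ι] [Finite κ] (f : ι → ℝ) (g : κ → ℝ)
    (h : ∀ i j, f i ≤ g j) : ∃ t, (∀ i, f i ≤ t) ∧ ∀ j, t ≤ g j := by
  rcases isEmpty_or_nonempty ι with hι | hι
  · exact ⟨⨅ j, g j, fun i => isEmptyElim i, ciInf_le (Set.finite_range g).bddBelow⟩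
  · exact ⟨⨆ i, f i, le_ciSup (Set.finite_range f).bddAbove, fun j => ciSup_le fun i => h i j⟩

/-! ### Convexity and covers by affine subspaces; projections of polyhedra. -/

section Polyhedra

variable {E : Type*} [AddCommGroup E] [Module ℝ E]

/-- A convex set that is covered by finitely many affine subspaces lies in one of them. -/
theorem Convex.exists_subset_of_subset_iUnion_affineSubspace {C : Set E} (hC : Convex ℝ C)
    (hne : C.Nonempty) {ι : Type*} [Finite ι] (A : ι → AffineSubspace ℝ E)
    (h : C ⊆ ⋃ i, (A i : Set E)) : ∃ i, C ⊆ (A i : Set E) := by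
  classical
  by_contra! hA
  have key : ∀ s : Finset ι, ∃ x ∈ C, ∀ i ∈ s, x ∉ A i := by
    intro s
    induction s using Finset.induction_on with
    | empty => exact ⟨_, hne.some_mem, by simp⟩
    | insert a s _ ih =>
      obtain ⟨x, hx, hxs⟩ := ih
      obtain ⟨y, hy, hya⟩ := Set.not_subset.1 (hA a)
      -- A subspace met at two parameters contains the whole line, hence both `x` and `y`; so each
      -- one excludes at most one `t`.
      have hfin : (⋃ i ∈ insert a s, {t : ℝ | AffineMap.lineMap x y t ∈ A i}).Finite := by
        refine Set.Finite.biUnion (Finset.finite_toSet _) fun i hi => Set.Subsingleton.finite ?_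
        intro t₁ h₁ t₂ h₂
        by_contra hne
        have hline : ∀ t : ℝ, AffineMap.lineMap x y t ∈ A i := by
          intro t
          have ht : AffineMap.lineMap t₁ t₂ ((t - t₁) / (t₂ - t₁)) = t := by
            have : t₂ - t₁ ≠ 0 := sub_ne_zero.2 (Ne.symm hne)
            rw [AffineMap.lineMap_apply, vsub_eq_sub, smul_eq_mul, vadd_eq_add]
            field_simp
            ring
          rw [← ht, AffineMap.apply_lineMap]
          exact AffineMap.lineMap_mem _ h₁ h₂
        rcases Finset.mem_insert.1 hi with rfl | hi
        · exact hya (by simpa using hline 1)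
        · exact hxs i hi (by simpa using hline 0)
      obtain ⟨t, ht, htb⟩ := (Set.Icc_infinite (zero_lt_one' ℝ)).exists_notMem_finite hfin
      refine ⟨AffineMap.lineMap x y t, hC.lineMap_mem hx hy ht, fun i hi hmem => htb ?_⟩
      exact Set.mem_biUnion hi hmem
  cases nonempty_fintype ι
  obtain ⟨x, hx, hxA⟩ := key Finset.univ
  obtain ⟨i, hi⟩ := Set.mem_iUnion.1 (h hx)
  exact hxA i (Finset.mem_univ i) hi

/-- A convex set on which no member of a finite family of linear functionals takes a given value
identically has a point at which all of them avoid their values. -/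
theorem Convex.exists_forall_ne {C : Set E} (hC : Convex ℝ C) (hne : C.Nonempty) {ι : Type*}
    [Finite ι] (φ : ι → E →ₗ[ℝ] ℝ) (b : ι → ℝ) (h : ∀ i, ∃ x ∈ C, φ i x ≠ b i) :
    ∃ x ∈ C, ∀ i, φ i x ≠ b i := by
  by_contra! hcon
  obtain ⟨i, hi⟩ := hC.exists_subset_of_subset_iUnion_affineSubspace hne
    (fun i => (AffineSubspace.mk' (b i) (⊥ : Submodule ℝ ℝ)).comap (φ i).toAffineMap) (by
      intro x hx
      obtain ⟨i, hi⟩ := hcon x hx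
      exact Set.mem_iUnion.2 ⟨i, by simp [hi]⟩)
  obtain ⟨x, hx, hxb⟩ := h i
  exact hxb (by simpa [sub_eq_zero] using hi hx)

theorem isPolyhedron_setOf_forall_le {ι : Type*} [Finite ι] (φ : ι → E →ₗ[ℝ] ℝ) (b : ι → ℝ) :
    IsPolyhedron {x | ∀ i, φ i x ≤ b i} := by
  obtain ⟨m, ⟨e⟩⟩ := Finite.exists_equiv_fin ι
  refine ⟨m, φ ∘ e.symm, b ∘ e.symm, ?_⟩
  ext x
  exact (e.symm.forall_congr_right (q := fun j => φ j x ≤ b j)).symm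

theorem isPolyhedron_setOf_le (φ : E →ₗ[ℝ] ℝ) (b : ℝ) : IsPolyhedron {x | φ x ≤ b} := by
  simpa using isPolyhedron_setOf_forall_le (fun _ : Unit => φ) fun _ => b

theorem isPolyhedron_setOf_ge (φ : E →ₗ[ℝ] ℝ) (b : ℝ) : IsPolyhedron {x | b ≤ φ x} := by
  simpa using isPolyhedron_setOf_le (-φ) (-b)

theorem IsPolyhedron.iInter {ι : Type*} [Finite ι] {P : ι → Set E} (h : ∀ i, IsPolyhedron (P i)) :
    IsPolyhedron (⋂ i, P i) := by
  choose m φ b hP using h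
  convert isPolyhedron_setOf_forall_le (fun p : Σ i, Fin (m i) => φ p.1 p.2) fun p => b p.1 p.2
  ext x
  simp [hP, Sigma.forall]

theorem IsPolyhedron.inter {P Q : Set E} (hP : IsPolyhedron P) (hQ : IsPolyhedron Q) :
    IsPolyhedron (P ∩ Q) := by
  rw [Set.inter_eq_iInter]
  exact IsPolyhedron.iInter (by rintro (_ | _) <;> assumption)

theorem isPolyhedron_setOf_eq (φ : E →ₗ[ℝ] ℝ) (b : ℝ) : IsPolyhedron {x | φ x = b} := by
  convert (isPolyhedron_setOf_le φ b).inter (isPolyhedron_setOf_ge φ b) using 1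
  ext x
  exact le_antisymm_iff

theorem IsPolyhedron.preimage {F : Type*} [AddCommGroup F] [Module ℝ F] {P : Set F}
    (hP : IsPolyhedron P) (g : E →ₗ[ℝ] F) : IsPolyhedron (g ⁻¹' P) := by
  obtain ⟨m, φ, b, rfl⟩ := hP
  exact ⟨m, fun i => φ i ∘ₗ g, b, rfl⟩

theorem IsPolyhedron.convex {P : Set E} (hP : IsPolyhedron P) : Convex ℝ P := by
  obtain ⟨m, φ, b, rfl⟩ := hP
  rw [Set.ofPred_forall]
  exact convex_iInter fun i => convex_halfSpace_le (φ i).isLinear _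

/-- Fourier–Motzkin elimination of one direction. -/
theorem IsPolyhedron.add_line {P : Set E} (hP : IsPolyhedron P) (v : E) :
    IsPolyhedron {x | ∃ t : ℝ, x + t • v ∈ P} := by
  obtain ⟨m, φ, b, rfl⟩ := hP
  have h₀ : IsPolyhedron {x | ∀ i : {i // φ i v = 0}, φ i x ≤ b i} :=
    isPolyhedron_setOf_forall_le (fun i : {i // φ i v = 0} => φ i) fun i => b i
  -- Positive combinations of two inequalities with opposite signs at `v`, weighted so that `v`
  -- cancels.
  have h₁ := isPolyhedron_setOf_forall_le
    (fun p : {i // 0 < φ i v} × {i // φ i v < 0} => φ p.1 v • φ p.2 - φ p.2 v • φ p.1)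
    (fun p => φ p.1 v * b p.2 - φ p.2 v * b p.1)
  convert h₀.inter h₁ using 1
  ext x
  simp only [Set.mem_ofPred_eq, Set.mem_inter_iff, map_add, map_smul, smul_eq_mul,
    LinearMap.sub_apply, LinearMap.smul_apply, Subtype.forall, Prod.forall]
  constructor
  · rintro ⟨t, ht⟩
    refine ⟨fun i hi => by simpa [hi] using ht i, fun i hi j hj => ?_⟩
    nlinarith [mul_le_mul_of_nonneg_left (ht j) hi.le,
      mul_le_mul_of_nonneg_left (ht i) (neg_nonneg.2 hj.le)]
  · rintro ⟨hx₀, hx₁⟩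
    obtain ⟨t, htl, htu⟩ : ∃ t : ℝ, (∀ j, φ j v < 0 → (b j - φ j x) / φ j v ≤ t) ∧
        ∀ i, 0 < φ i v → t ≤ (b i - φ i x) / φ i v := by
      obtain ⟨t, h₁, h₂⟩ := exists_between_of_finite
        (fun j : {j // φ j v < 0} => (b j - φ j x) / φ j v)
        (fun i : {i // 0 < φ i v} => (b i - φ i x) / φ i v) (by
          rintro ⟨j, hj⟩ ⟨i, hi⟩
          rw [div_le_iff_of_neg hj, div_mul_eq_mul_div, div_le_iff₀ hi]
          linarith [hx₁ i hi j hj])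
      exact ⟨t, fun j hj => h₁ ⟨j, hj⟩, fun i hi => h₂ ⟨i, hi⟩⟩
    refine ⟨t, fun i => ?_⟩
    rcases lt_trichotomy (φ i v) 0 with hi | hi | hi
    · have := (div_le_iff_of_neg hi).1 (htl i hi)
      linarith
    · simpa [hi] using hx₀ i hi
    · have := (le_div_iff₀ hi).1 (htu i hi)
      linarith

theorem IsPolyhedron.add_submodule {N : Submodule ℝ E} (hN : N.FG) {P : Set E}
    (hP : IsPolyhedron P) : IsPolyhedron {x | ∃ u ∈ N, x + u ∈ P} := by
  induction N, hN using Submodule.fg_induction generalizing P with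
  | singleton v =>
    simpa [Submodule.mem_span_singleton] using hP.add_line v
  | sup N₁ N₂ _ _ h₁ h₂ =>
    convert h₁ (h₂ hP) using 1
    ext x
    simp only [Set.mem_ofPred_eq, Submodule.mem_sup]
    constructor
    · rintro ⟨_, ⟨y, hy, z, hz, rfl⟩, h⟩
      exact ⟨y, hy, z, hz, by rwa [add_assoc]⟩
    · rintro ⟨y, hy, z, hz, h⟩
      exact ⟨_, ⟨y, hy, z, hz, rfl⟩, by rwa [← add_assoc]⟩

/-- The image of a polyhedron under a surjective linear map is a polyhedron. -/
theorem IsPolyhedron.image_of_surjective [FiniteDimensional ℝ E] {F : Type*} [AddCommGroup F] [Module ℝ F]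
    {P : Set E} (hP : IsPolyhedron P) (g : E →ₗ[ℝ] F) (hg : Function.Surjective g) :
    IsPolyhedron (g '' P) := by
  obtain ⟨s, hs⟩ := g.exists_rightInverse_of_surjective (LinearMap.range_eq_top.2 hg)
  have hs' : ∀ y, g (s y) = y := fun y => LinearMap.congr_fun hs y
  -- With a linear section `s`, a point `y` is in the image iff `s y` lies in `P` up to the kernel.
  convert (hP.add_submodule (IsNoetherian.noetherian (LinearMap.ker g))).preimage s using 1
  ext y
  constructor
  · rintro ⟨x, hx, rfl⟩
    exact ⟨x - s (g x), by simp [hs'], by simpa using hx⟩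
  · rintro ⟨u, hu, h⟩
    exact ⟨_, h, by rw [map_add, hs', LinearMap.mem_ker.1 hu, add_zero]⟩

theorem isPolyhedron_zero [FiniteDimensional ℝ E] : IsPolyhedron ({0} : Set E) := by
  have B := Module.finBasis ℝ E
  convert IsPolyhedron.iInter fun i => isPolyhedron_setOf_eq (B.coord i) 0 using 1
  ext x
  rw [Set.mem_singleton_iff, ← B.forall_coord_eq_zero_iff, Set.mem_iInter]
  rfl

/-- The image of a polyhedron under a linear map is a polyhedron. -/
theorem IsPolyhedron.image [FiniteDimensional ℝ E] {F : Type*} [AddCommGroup F] [Module ℝ F]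
    [FiniteDimensional ℝ F] {P : Set E} (hP : IsPolyhedron P) (g : E →ₗ[ℝ] F) :
    IsPolyhedron (g '' P) := by
  -- Project the graph of `g` over `P` to the second factor.
  convert ((hP.preimage (LinearMap.fst ℝ E F)).inter (isPolyhedron_zero.preimage
    (g ∘ₗ LinearMap.fst ℝ E F - LinearMap.snd ℝ E F))).image_of_surjective
    (LinearMap.snd ℝ E F) LinearMap.snd_surjective using 1
  ext y
  constructor
  · rintro ⟨x, hx, rfl⟩
    exact ⟨(x, g x), by simpa using hx, rfl⟩
  · rintro ⟨⟨x, z⟩, ⟨hx, hz⟩, rfl⟩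
    exact ⟨x, hx, by simpa [sub_eq_zero] using hz⟩

end Polyhedra

/-! ### Hyperplane arrangements and their closed cells. -/

section Arrangement

variable {E : Type*} [AddCommGroup E] [Module ℝ E] {ι : Type*}

/-- The closed cell with sign vector `σ` of the arrangement of the hyperplanes `φ i x = b i`. -/
def signCell (φ : ι → E →ₗ[ℝ] ℝ) (b : ι → ℝ) (σ : ι → SignType) : Set E :=
  {x | ∀ i, φ i x = b i ∨ SignType.sign (φ i x - b i) = σ i}

variable {φ : ι → E →ₗ[ℝ] ℝ} {b : ι → ℝ} {σ τ : ι → SignType}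

theorem isPolyhedron_signCell [Finite ι] : IsPolyhedron (signCell φ b σ) := by
  rw [signCell, Set.ofPred_forall]
  refine IsPolyhedron.iInter fun i => ?_
  rcases hσ : σ i with _ | _ | _
  · convert isPolyhedron_setOf_eq (φ i) (b i) using 1
    ext x
    simp [sub_eq_zero]
  · convert isPolyhedron_setOf_le (φ i) (b i) using 1
    ext x
    change (φ i x = b i ∨ SignType.sign (φ i x - b i) = -1) ↔ φ i x ≤ b i
    rw [sign_eq_neg_one_iff, sub_neg, le_iff_eq_or_lt]
  · convert isPolyhedron_setOf_ge (φ i) (b i) using 1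
    ext x
    change (φ i x = b i ∨ SignType.sign (φ i x - b i) = 1) ↔ b i ≤ φ i x
    rw [sign_eq_one_iff, sub_pos, le_iff_eq_or_lt, eq_comm]

theorem sign_mul_eq_abs_of_mem_signCell {x : E} (hx : x ∈ signCell φ b σ) (i : ι) :
    (σ i : ℝ) * (φ i x - b i) = |φ i x - b i| := by
  rcases hx i with h | h
  · simp [h]
  · rw [← h, sign_mul_self]

/-- On the cell, `σ i * (φ i x - b i)` is an absolute value, so a sum of these over `T` is
nonnegative and vanishes exactly when every term does. -/
theorem isFace_signCell_of_eqOn [Finite ι] (T : Set ι) :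
    IsFace (signCell φ b σ) {x ∈ signCell φ b σ | ∀ i ∈ T, φ i x = b i} := by
  classical
  cases nonempty_fintype ι
  have key : ∀ x ∈ signCell φ b σ, (-∑ i with i ∈ T, (σ i : ℝ) • φ i) x =
      (-∑ i with i ∈ T, (σ i : ℝ) * b i) - ∑ i with i ∈ T, |φ i x - b i| := by
    intro x hx
    simp only [← sign_mul_eq_abs_of_mem_signCell hx, mul_sub, Finset.sum_sub_distrib]
    simp only [LinearMap.neg_apply, LinearMap.sum_apply, LinearMap.smul_apply, smul_eq_mul]
    ring
  have hnn : ∀ x, 0 ≤ ∑ i with i ∈ T, |φ i x - b i| :=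
    fun x => Finset.sum_nonneg fun i _ => abs_nonneg _
  refine ⟨-∑ i with i ∈ T, (σ i : ℝ) • φ i, -∑ i with i ∈ T, (σ i : ℝ) * b i, fun x hx => ?_, ?_⟩
  · rw [key x hx]
    linarith [hnn x]
  · ext x
    refine and_congr_right fun hx => ?_
    rw [key x hx, sub_eq_self, Finset.sum_eq_zero_iff_of_nonneg fun i _ => abs_nonneg _]
    simp [sub_eq_zero]

theorem signCell_inter_signCell :
    signCell φ b σ ∩ signCell φ b τ =
      {x ∈ signCell φ b σ | ∀ i ∈ {i | σ i ≠ τ i}, φ i x = b i} := by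
  ext x
  refine and_congr_right fun hx => ⟨fun hx' i hi => ?_, fun h i => ?_⟩
  · by_contra hne
    exact hi (((hx i).resolve_left hne).symm.trans ((hx' i).resolve_left hne))
  · by_cases hi : σ i = τ i
    · exact hi ▸ hx i
    · exact Or.inl (h i hi)

theorem signCell_eqOn_eq (T : Set ι) [DecidablePred (· ∈ T)] :
    {x ∈ signCell φ b σ | ∀ i ∈ T, φ i x = b i} =
      signCell φ b fun i => if i ∈ T then 0 else σ i := by
  ext x
  simp only [signCell, Set.mem_ofPred_eq, ← forall_and]
  refine forall_congr' fun i => ?_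
  by_cases hi : i ∈ T
  · simp [hi, sub_eq_zero]
    tauto
  · simp [hi]

/-- Every nonempty face of a cell of a hyperplane arrangement is cut out by hyperplanes of the
arrangement. -/
theorem IsFace.exists_eqOn_of_signCell [Finite ι] {F : Set E} (hF : IsFace (signCell φ b σ) F)
    (hne : F.Nonempty) :
    ∃ T : Set ι, F = {x ∈ signCell φ b σ | ∀ i ∈ T, φ i x = b i} := by
  obtain ⟨ψ, c, hψ, rfl⟩ := hF
  set F := {x ∈ signCell φ b σ | ψ x = c}
  have hconv : Convex ℝ F :=
    (isPolyhedron_signCell.inter (isPolyhedron_setOf_eq ψ c)).convex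
  let T : Set ι := {i | ∀ y ∈ F, φ i y = b i}
  -- `x` acts as a relative interior point of `F`: it lies only on those hyperplanes that contain
  -- all of `F`.
  obtain ⟨x, hx, hxT⟩ := hconv.exists_forall_ne hne (fun i : {i // i ∉ T} => φ i) (fun i => b i)
    fun i => by simpa [T] using i.2
  refine ⟨T, Set.Subset.antisymm (fun y hy => ⟨hy.1, fun i hi => hi y hy⟩) fun y hy => ?_⟩
  refine ⟨hy.1, (hψ y hy.1).antisymm ?_⟩
  -- Moving slightly past `x`, away from `y`, stays in the cell. Validity of `ψ ≤ c` there forces `ψ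
  -- y ≥ c`.
  have hev : ∀ᶠ ε : ℝ in nhds 0, x + ε • (x - y) ∈ signCell φ b σ := by
    refine Filter.eventually_all.2 fun i => ?_
    by_cases hi : i ∈ T
    · refine Filter.Eventually.of_forall fun ε => Or.inl ?_
      simp [hi x hx, hy.2 i hi]
    · have hxi : φ i x - b i ≠ 0 := sub_ne_zero.2 (hxT ⟨i, hi⟩)
      have hcont : Continuous fun ε : ℝ => φ i x - b i + ε * (φ i x - φ i y) := by fun_prop
      have hlim := hcont.tendsto 0
      rw [zero_mul, add_zero] at hlim
      have hσ : SignType.sign (φ i x - b i) = σ i := (hx.1 i).resolve_left (hxT ⟨i, hi⟩)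
      have hev : ∀ᶠ ε : ℝ in nhds 0,
          SignType.sign (φ i x - b i + ε * (φ i x - φ i y)) = SignType.sign (φ i x - b i) :=
        ((continuousAt_sign_of_ne_zero hxi).tendsto.comp hlim).eventually_mem
          (s := {SignType.sign (φ i x - b i)}) (by simp)
      filter_upwards [hev] with ε hε
      right
      rw [← hσ, ← hε]
      simp [add_sub_right_comm]
  obtain ⟨ε, hε, hmem⟩ :=
    ((eventually_mem_nhdsWithin (a := (0 : ℝ)) (s := Set.Ioi 0)).and
      (hev.filter_mono nhdsWithin_le_nhds)).exists
  have h := hψ _ hmem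
  rw [map_add, map_smul, map_sub, hx.2, smul_eq_mul] at h
  have hε : 0 < ε := hε
  nlinarith

/-- The polyhedral complex of the closed cells of a hyperplane arrangement that lie in a given
set. -/
def arrangementComplex [Finite ι] (φ : ι → E →ₗ[ℝ] ℝ) (b : ι → ℝ) (S : Set E) :
    PolyhedralComplex E where
  cells := {P | (∃ σ, P = signCell φ b σ) ∧ P.Nonempty ∧ P ⊆ S}
  finite := (Set.finite_range (signCell φ b)).subset (by
    rintro _ ⟨⟨σ, rfl⟩, _⟩
    exact ⟨σ, rfl⟩)
  nonempty := fun _ hP => hP.2.1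
  polyhedron := by
    rintro _ ⟨⟨σ, rfl⟩, _⟩
    exact isPolyhedron_signCell
  face_mem := by
    classical
    rintro _ ⟨⟨σ, rfl⟩, _, hS⟩ F hF hne
    obtain ⟨T, rfl⟩ := hF.exists_eqOn_of_signCell hne
    exact ⟨⟨_, signCell_eqOn_eq T⟩, hne, fun x hx => hS hx.1⟩
  inter_face := by
    rintro _ ⟨⟨σ, rfl⟩, _⟩ _ ⟨⟨τ, rfl⟩, _⟩
    rw [signCell_inter_signCell]
    exact isFace_signCell_of_eqOn _

/-- A finite union of polyhedra is the support of a finite polyhedral complex. -/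
theorem exists_polyhedralComplex_support_eq_iUnion {κ : Type*} [Finite κ] {P : κ → Set E}
    (hP : ∀ t, IsPolyhedron (P t)) :
    ∃ K : PolyhedralComplex E, K.support = ⋃ t, P t := by
  choose m φ b hP using hP
  let φ' : (Σ t, Fin (m t)) → E →ₗ[ℝ] ℝ := fun p => φ p.1 p.2
  let b' : (Σ t, Fin (m t)) → ℝ := fun p => b p.1 p.2
  refine ⟨arrangementComplex φ' b' (⋃ t, P t), Set.Subset.antisymm ?_ fun x hx => ?_⟩
  · exact Set.sUnion_subset fun Q hQ => hQ.2.2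
  -- The closed cell of `x` stays in every `P t` containing `x`, since its points violate no
  -- inequality that `x` satisfies.
  · have hxm : x ∈ signCell φ' b' fun p => SignType.sign (φ' p x - b' p) := fun p => Or.inr rfl
    refine Set.mem_sUnion.2 ⟨_, ⟨⟨_, rfl⟩, ⟨x, hxm⟩, fun y hy => ?_⟩, hxm⟩
    obtain ⟨t, ht⟩ := Set.mem_iUnion.1 hx
    refine Set.mem_iUnion.2 ⟨t, ?_⟩
    rw [hP] at ht ⊢
    intro i
    rcases hy ⟨t, i⟩ with h | h
    · exact h.le
    · by_contra! hlt
      have hpos : 0 < φ' ⟨t, i⟩ y - b' ⟨t, i⟩ := sub_pos.2 hlt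
      rw [sign_pos hpos, eq_comm, sign_eq_one_iff] at h
      exact (sub_pos.1 h).not_ge (ht i)

end Arrangement

/-! ### Cutting a finite set of reals into blocks. -/

/-- If `n` distinct real numbers are cut in increasing order into `k + 1` consecutive blocks of `D`
numbers, the last block taking what is left or blocks staying empty at the end, then real
thresholds separate the blocks. -/
theorem exists_consecutive_blocks {n : ℕ} (t : Fin n → ℝ) (ht : Function.Injective t) (k : ℕ)
    {D : ℕ} (hD : 0 < D) :
    ∃ (I : Fin n → Fin (k + 1)) (s : ℕ → ℝ),
      (∀ i l, (I i : ℕ) ≤ l → l < k → t i < s l) ∧ (∀ i l, l < (I i : ℕ) → s l < t i) ∧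
      ((k + 1) * D ≤ n → ∀ j, D ≤ (Finset.univ.filter fun i => I i = j).card) ∧
      (n ≤ (k + 1) * D → ∀ j, (Finset.univ.filter fun i => I i = j).card ≤ D) := by
  obtain ⟨σ, hσ⟩ : ∃ σ : Equiv.Perm (Fin n), StrictMono (t ∘ σ) :=
    ⟨Tuple.sort t, (Tuple.monotone_sort t).strictMono_of_injective
      (ht.comp (Tuple.sort t).injective)⟩
  have hlt : ∀ i i', (σ.symm i : ℕ) < σ.symm i' → t i < t i' := fun i i' h => by
    simpa using hσ (Fin.lt_def.2 h)
  have hs : ∀ l : ℕ, ∃ s : ℝ, (∀ x ∈ t '' {i | (σ.symm i : ℕ) < (l + 1) * D}, x < s) ∧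
      ∀ x ∈ t '' {i | (l + 1) * D ≤ (σ.symm i : ℕ)}, s < x := fun l =>
    Set.Finite.exists_between' (Set.toFinite _) (Set.toFinite _) (by
      rintro _ ⟨i, hi, rfl⟩ _ ⟨i', hi', rfl⟩
      exact hlt _ _ (lt_of_lt_of_le hi hi'))
  choose s hs₁ hs₂ using hs
  -- `σ.symm i` is the rank of `t i`. The cap at `k` sends all leftover ranks to the last block.
  refine ⟨fun i => ⟨min ((σ.symm i : ℕ) / D) k, by omega⟩, s, fun i l hil hlk => ?_,
    fun i l hil => ?_, fun hn j => ?_, fun hn j => ?_⟩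
  · refine hs₁ l _ ⟨i, ?_, rfl⟩
    have : (σ.symm i : ℕ) / D < l + 1 := by
      simp only at hil
      omega
    exact (Nat.div_lt_iff_lt_mul hD).1 this
  · refine hs₂ l _ ⟨i, ?_, rfl⟩
    have : l + 1 ≤ (σ.symm i : ℕ) / D := by
      simp only at hil
      omega
    exact (Nat.le_div_iff_mul_le hD).1 this
  · have hj : ∀ r : Fin D, (j : ℕ) * D + r < n := fun r => by
      have : ((j : ℕ) + 1) * D ≤ (k + 1) * D := Nat.mul_le_mul_right _ j.2
      rw [add_mul, one_mul] at this
      omega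
    calc D = (Finset.univ : Finset (Fin D)).card := by simp
      _ ≤ _ := Finset.card_le_card_of_injOn (fun r => σ ⟨j * D + r, hj r⟩) (fun r _ => by
          have : ((j : ℕ) * D + r) / D = j := by
            rw [mul_comm, Nat.mul_add_div hD, Nat.div_eq_of_lt r.2, add_zero]
          simp [Fin.ext_iff, this]
          omega) (fun r _ r' _ h => by simpa [Fin.ext_iff] using h)
  · calc _ ≤ (Finset.range D).card := Finset.card_le_card_of_injOn (fun i => (σ.symm i : ℕ) % D)
          (fun i _ => by simpa using Nat.mod_lt _ hD) (fun i hi i' hi' h => by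
            have key : ∀ i : Fin n, (σ.symm i : ℕ) / D ≤ k := fun i =>
              Nat.lt_succ_iff.1 ((Nat.div_lt_iff_lt_mul hD).2 ((σ.symm i).2.trans_le hn))
            simp only [Finset.coe_filter, Finset.mem_univ, true_and, Set.mem_ofPred_eq,
              Fin.ext_iff, min_eq_left (key _)] at hi hi'
            have : (σ.symm i : ℕ) = σ.symm i' := by
              rw [← Nat.div_add_mod (σ.symm i : ℕ) D, ← Nat.div_add_mod (σ.symm i' : ℕ) D, hi, hi']
              simp only at h
              rw [h]
            exact σ.symm.injective (Fin.ext this))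
      _ = D := by simp

/-! ### Affine functions on points in general position. -/

section Configuration

variable {ι : Type*} {d : ℕ}

/-- The linear map taking the affine function `x ↦ a ⬝ᵥ x + c` on `ℝᵈ`, encoded as `(a, c)`, to
its values on a point configuration. -/
def affineEval (v : ι → Fin d → ℝ) : ((Fin d → ℝ) × ℝ) →ₗ[ℝ] (ι → ℝ) :=
  LinearMap.pi fun i =>
    (dotProductBilin ℝ ℝ).flip (v i) ∘ₗ LinearMap.fst ℝ _ _ + LinearMap.snd ℝ _ _

theorem affineEval_apply (v : ι → Fin d → ℝ) (f : (Fin d → ℝ) × ℝ) (i : ι) :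
    affineEval v f i = f.1 ⬝ᵥ v i + f.2 := rfl

variable {v : ι → Fin d → ℝ}

/-- A nonzero linear part would put the `d + 1` points on a hyperplane; a constant with a zero
vanishes. -/
theorem InGeneralPosition.eq_zero_of_affineEval_eq_zero (hv : InGeneralPosition v) {s : Finset ι}
    (hs : s.card = d + 1) {f : (Fin d → ℝ) × ℝ} (hf : ∀ i ∈ s, affineEval v f i = 0) : f = 0 := by
  obtain ⟨a, c⟩ := f
  simp only [affineEval_apply] at hf
  obtain ⟨i₀, hi₀⟩ : s.Nonempty := Finset.card_pos.1 (by omega)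
  by_cases ha : a = 0
  · have := hf i₀ hi₀
    simp_all
  · exfalso
    let φ : Module.Dual ℝ (Fin d → ℝ) := dotProductBilin ℝ ℝ a
    have hφ : φ ≠ 0 := fun h => ha (dotProduct_self_eq_zero.1 (LinearMap.congr_fun h a))
    refine hv s hs (AffineSubspace.mk' (v i₀) (LinearMap.ker φ)) ?_ fun i hi => ?_
    · rw [AffineSubspace.direction_mk', Module.Dual.finrank_ker_add_one_of_ne_zero hφ]
      simp
    · rw [AffineSubspace.mem_mk', LinearMap.mem_ker, vsub_eq_sub, map_sub, sub_eq_zero]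
      change a ⬝ᵥ v i = a ⬝ᵥ v i₀
      linarith [hf i hi, hf i₀ hi₀]

/-- Evaluation at `d + 1` points is injective between spaces of dimension `d + 1`, hence surjective.
-/
theorem InGeneralPosition.exists_affineEval_eq [Fintype ι] (hv : InGeneralPosition v)
    (hd : d + 1 ≤ Fintype.card ι) {s : Finset ι} (hs : s.card ≤ d + 1) (g : ι → ℝ) :
    ∃ f, ∀ i ∈ s, affineEval v f i = g i := by
  obtain ⟨t, hst, ht⟩ := Finset.exists_superset_card_eq hs hd
  let R : ((Fin d → ℝ) × ℝ) →ₗ[ℝ] (t → ℝ) := LinearMap.funLeft ℝ ℝ Subtype.val ∘ₗ affineEval v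
  have hinj : Function.Injective R := by
    refine (injective_iff_map_eq_zero R).2 fun f hf => ?_
    exact hv.eq_zero_of_affineEval_eq_zero ht fun i hi => congr_fun hf ⟨i, hi⟩
  have hsurj := (LinearMap.injective_iff_surjective_of_finrank_eq_finrank (f := R)
    (by simp [ht])).1 hinj
  obtain ⟨f, hf⟩ := hsurj fun i => g i
  exact ⟨f, fun i hi => congr_fun hf ⟨i, hst hi⟩⟩

/-- Two values can be prescribed freely because `2 ≤ d + 1`, so each coincidence is a proper linear
condition and a generic function avoids them all. -/
theorem InGeneralPosition.exists_affineEval_injective [Fintype ι] (hv : InGeneralPosition v)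
    (hd₁ : 1 ≤ d) (hd : d + 1 ≤ Fintype.card ι) : ∃ f, Function.Injective (affineEval v f) := by
  classical
  obtain ⟨f, -, hf⟩ := (convex_univ (𝕜 := ℝ)).exists_forall_ne ⟨0, trivial⟩
    (fun p : {p : ι × ι // p.1 ≠ p.2} => LinearMap.proj p.1.1 ∘ₗ affineEval v -
      LinearMap.proj p.1.2 ∘ₗ affineEval v) (fun _ => 0) (by
      rintro ⟨⟨i, j⟩, hij⟩
      obtain ⟨f, hf⟩ := hv.exists_affineEval_eq hd (s := {i, j})
        (Finset.card_le_two.trans (by omega)) (Pi.single i 1)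
      have hi := hf i (by simp)
      have hj := hf j (by simp)
      rw [Pi.single_eq_same] at hi
      rw [Pi.single_eq_of_ne (Ne.symm hij)] at hj
      exact ⟨f, trivial, by simp [hi, hj]⟩)
  refine ⟨f, fun i j hij => ?_⟩
  by_contra hne
  exact hf ⟨(i, j), hne⟩ (by simp [hij])

variable {κ : Type*}

/-- The linear map taking a family of affine functions to the vector whose `i`-th coordinate is
the value at `v i` of the function with index `I i`. -/
def selectEval (v : ι → Fin d → ℝ) (I : ι → κ) : (κ → (Fin d → ℝ) × ℝ) →ₗ[ℝ] (ι → ℝ) :=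
  LinearMap.pi fun i => LinearMap.proj i ∘ₗ affineEval v ∘ₗ LinearMap.proj (I i)

theorem selectEval_apply (v : ι → Fin d → ℝ) (I : ι → κ) (f : κ → (Fin d → ℝ) × ℝ) (i : ι) :
    selectEval v I f i = affineEval v (f (I i)) i := rfl

/-- The families of affine functions for which the function with index `I i` is minimal at
`v i`. -/
def minRegion (v : ι → Fin d → ℝ) (I : ι → κ) : Set (κ → (Fin d → ℝ) × ℝ) :=
  {f | ∀ i j, affineEval v (f (I i)) i ≤ affineEval v (f j) i}

theorem isPolyhedron_minRegion [Finite ι] [Finite κ] (v : ι → Fin d → ℝ) (I : ι → κ) :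
    IsPolyhedron (minRegion v I) := by
  let φ (p : ι × κ) : (κ → (Fin d → ℝ) × ℝ) →ₗ[ℝ] ℝ :=
    LinearMap.proj p.1 ∘ₗ affineEval v ∘ₗ LinearMap.proj (I p.1) -
      LinearMap.proj p.1 ∘ₗ affineEval v ∘ₗ LinearMap.proj p.2
  convert isPolyhedron_setOf_forall_le φ (fun _ => 0) using 1
  ext f
  exact ⟨fun h p => sub_nonpos.2 (h p.1 p.2), fun h i j => sub_nonpos.1 (h (i, j))⟩

/-- The strict inequalities cut out a nonempty open subset of the region. -/
theorem vectorSpan_minRegion_eq_top [Finite ι] [Finite κ] {I : ι → κ}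
    (h : ∃ f : κ → (Fin d → ℝ) × ℝ,
      ∀ i j, j ≠ I i → affineEval v (f (I i)) i < affineEval v (f j) i) :
    vectorSpan ℝ (minRegion v I) = ⊤ := by
  cases nonempty_fintype κ
  let U : Set (κ → (Fin d → ℝ) × ℝ) :=
    {f | ∀ i j, j ≠ I i → affineEval v (f (I i)) i < affineEval v (f j) i}
  have hcont : ∀ i, Continuous fun f : (Fin d → ℝ) × ℝ => affineEval v f i := fun i =>
    (LinearMap.proj (R := ℝ) (φ := fun _ : ι => ℝ) i ∘ₗ
      affineEval v).continuous_of_finiteDimensional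
  have hU : IsOpen U := by
    simp only [U, Set.ofPred_forall]
    refine isOpen_iInter_of_finite fun i => isOpen_iInter_of_finite fun j =>
      isOpen_iInter_of_finite fun _ => ?_
    exact isOpen_lt ((hcont i).comp (continuous_apply _)) ((hcont i).comp (continuous_apply _))
  have hsub : U ⊆ minRegion v I := fun f hf i j => by
    by_cases hj : j = I i
    · rw [hj]
    · exact (hf i j hj).le
  have hspan : vectorSpan ℝ U = ⊤ := by
    rw [← direction_affineSpan, hU.affineSpan_eq_top h, AffineSubspace.direction_top]
  exact top_unique (hspan ▸ vectorSpan_mono ℝ hsub)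

theorem InGeneralPosition.selectEval_injective [Fintype ι] [DecidableEq κ]
    (hv : InGeneralPosition v) {I : ι → κ}
    (hI : ∀ j, d + 1 ≤ (Finset.univ.filter fun i => I i = j).card) :
    Function.Injective (selectEval v I) := by
  refine (injective_iff_map_eq_zero _).2 fun f hf => funext fun j => ?_
  obtain ⟨s, hs, hcard⟩ := Finset.exists_subset_card_eq (hI j)
  refine hv.eq_zero_of_affineEval_eq_zero hcard fun i hi => ?_
  obtain rfl : I i = j := by simpa using hs hi
  exact congr_fun hf i

theorem InGeneralPosition.selectEval_surjective [Fintype ι] [DecidableEq κ]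
    (hv : InGeneralPosition v) (hd : d + 1 ≤ Fintype.card ι) {I : ι → κ}
    (hI : ∀ j, (Finset.univ.filter fun i => I i = j).card ≤ d + 1) :
    Function.Surjective (selectEval v I) := by
  intro g
  choose f hf using fun j => hv.exists_affineEval_eq hd (hI j) g
  exact ⟨f, funext fun i => hf (I i) i (by simp)⟩

/-- A configuration in general position can be cut by parallel hyperplanes into consecutive slabs
such that the evaluation map has the largest possible rank. -/
theorem InGeneralPosition.exists_selectEval_finrank_ge {n k : ℕ} {v : Fin n → Fin d → ℝ}
    (hv : InGeneralPosition v) (hd₁ : 1 ≤ d) (hd : d + 1 ≤ n) :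
    ∃ I : Fin n → Fin (k + 1), vectorSpan ℝ (minRegion v I) = ⊤ ∧
      min ((k + 1) * (d + 1)) n ≤ Module.finrank ℝ (LinearMap.range (selectEval v I)) := by
  have hd' : d + 1 ≤ Fintype.card (Fin n) := by simpa using hd
  obtain ⟨u, hu⟩ := hv.exists_affineEval_injective hd₁ hd'
  obtain ⟨I, s, hlow, hup, hge, hle⟩ := exists_consecutive_blocks _ hu k (Nat.succ_pos d)
  refine ⟨I, vectorSpan_minRegion_eq_top
    -- Passing from index `l` to `l + 1` adds `s l - u`, which at `v i` is negative for `l < I i`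
    -- and positive from `I i` on; so the strict minimum over `j` is at `I i`.
    ⟨fun j => ∑ l ∈ Finset.range j, ((0, s l) - u), fun i j hj => ?_⟩, ?_⟩
  · have hval : ∀ j : ℕ, affineEval v (∑ l ∈ Finset.range j, ((0, s l) - u)) i =
        ∑ l ∈ Finset.range j, (s l - affineEval v u i) := by
      intro j
      rw [map_sum, Finset.sum_apply]
      refine Finset.sum_congr rfl fun l _ => ?_
      rw [map_sub, Pi.sub_apply, affineEval_apply v (0, s l), zero_dotProduct, zero_add]
    rw [hval, hval]
    rcases lt_or_gt_of_ne (Fin.val_ne_of_ne hj) with h | h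
    · rw [← Finset.sum_range_add_sum_Ico _ h.le, add_lt_iff_neg_left]
      refine Finset.sum_neg (fun l hl => sub_neg.2 (hup i l (Finset.mem_Ico.1 hl).2)) ?_
      simpa using h
    · rw [← Finset.sum_range_add_sum_Ico (fun l => s l - affineEval v u i) h.le,
        lt_add_iff_pos_right]
      refine Finset.sum_pos (fun l hl => sub_pos.2 (hlow i l (Finset.mem_Ico.1 hl).1 ?_)) ?_
      · have := (Finset.mem_Ico.1 hl).2
        omega
      · simpa using h
  · rcases le_total ((k + 1) * (d + 1)) n with h | h
    · rw [LinearMap.finrank_range_of_inj (hv.selectEval_injective (hge h)),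
        Module.finrank_pi_fintype]
      simp [h]
    · rw [LinearMap.range_eq_top.2 (hv.selectEval_surjective hd' (hle h))]
      simp

end Configuration

/-! ### The secant variety as a union of linear images. -/

section Secant

open Module

variable {n d k : ℕ}

theorem one_ne_zero_fin_fun : (fun _ => 1 : Fin (n + 1) → ℝ) ≠ 0 :=
  fun h => one_ne_zero (congr_fun h 0)

theorem finrank_tropProj : finrank ℝ (TropProj n) = n := by
  have h := Submodule.finrank_quotient_add_finrank
    (Submodule.span ℝ {(fun _ => 1 : Fin (n + 1) → ℝ)})
  rw [finrank_span_singleton one_ne_zero_fin_fun, finrank_fin_fun] at h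
  exact Nat.succ_injective h

/-- The quotient map `ℝⁿ⁺¹ → 𝕋ℙⁿ`. -/
def tropMk (n : ℕ) : (Fin (n + 1) → ℝ) →ₗ[ℝ] TropProj n := Submodule.mkQ _

theorem tropMk_const (c : ℝ) : tropMk n (fun _ => c) = 0 := by
  refine (Submodule.Quotient.mk_eq_zero _).2 (Submodule.mem_span_singleton.2 ⟨c, ?_⟩)
  ext
  simp

theorem finrank_le_finrank_map_tropMk_add_one (W : Submodule ℝ (Fin (n + 1) → ℝ)) :
    finrank ℝ W ≤ finrank ℝ (W.map (tropMk n)) + 1 := by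
  have hker : finrank ℝ (LinearMap.ker (tropMk n)) = 1 := by
    rw [tropMk, Submodule.ker_mkQ, finrank_span_singleton one_ne_zero_fin_fun]
  rw [← LinearMap.finrank_range_add_finrank_ker ((tropMk n).domRestrict W),
    LinearMap.range_domRestrict, add_le_add_iff_left, LinearMap.ker_domRestrict,
    ← Submodule.finrank_map_subtype_eq]
  exact (Submodule.finrank_mono (Submodule.map_comap_le _ _)).trans hker.le

/-- The linear part holds the coefficients of the rows of `M`; the constant is the ambiguity of the
representative. -/
theorem mk_mem_iff_exists_affineEval {L : Submodule ℝ (TropProj n)}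
    {M : Matrix (Fin d) (Fin (n + 1)) ℝ}
    (hM : Submodule.span ℝ (Set.range fun r => TropProj.mk (M r)) = L) (z : Fin (n + 1) → ℝ) :
    TropProj.mk z ∈ L ↔ ∃ f, affineEval (fun i => M.col i) f = z := by
  have hval : ∀ f, affineEval (fun i => M.col i) f = ∑ r, f.1 r • M r + fun _ => f.2 := by
    intro f
    ext i
    simp [affineEval_apply, dotProduct]
  rw [← hM, Submodule.mem_span_range_iff_exists_fun]
  constructor
  · rintro ⟨a, ha⟩
    have h : tropMk n (z - ∑ r, a r • M r) = 0 := by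
      simp only [map_sub, map_sum, map_smul]
      exact sub_eq_zero.2 ha.symm
    obtain ⟨c, hc⟩ := Submodule.mem_span_singleton.1 ((Submodule.Quotient.mk_eq_zero _).1 h)
    refine ⟨(a, c), ?_⟩
    rw [hval, ← add_sub_cancel (∑ r, a r • M r) z, ← hc]
    congr 1
    ext
    simp
  · rintro ⟨f, rfl⟩
    refine ⟨f.1, ?_⟩
    rw [hval]
    change _ = tropMk n _
    rw [map_add, tropMk_const, add_zero, map_sum]
    simp only [map_smul]
    rfl

/-- The secant variety is the union of linear images of the regions on which a fixed affine
function is minimal at each point. -/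
theorem tropSecant_eq_iUnion {L : Submodule ℝ (TropProj n)}
    {M : Matrix (Fin d) (Fin (n + 1)) ℝ}
    (hM : Submodule.span ℝ (Set.range fun r => TropProj.mk (M r)) = L) :
    tropSecant k L = ⋃ I : Fin (n + 1) → Fin (k + 1),
      (tropMk n ∘ₗ selectEval (fun i => M.col i) I) '' minRegion (fun i => M.col i) I := by
  ext p
  simp only [tropSecant, mk_mem_iff_exists_affineEval hM, Set.mem_iUnion, Set.mem_ofPred_eq]
  constructor
  · rintro ⟨y, hy, rfl⟩
    choose f hf using hy
    choose I hI using fun i => Finset.exists_mem_eq_inf' (Finset.univ_nonempty) fun j => y j i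
    refine ⟨I, f, fun i j => ?_, congr_arg (tropMk n) (funext fun i => ?_)⟩
    · rw [hf, hf, ← (hI i).2]
      exact Finset.inf'_le _ (Finset.mem_univ j)
    · rw [selectEval_apply, hf, ← (hI i).2, tropSum]
  · rintro ⟨I, f, hf, rfl⟩
    refine ⟨fun j => affineEval _ (f j), fun j => ⟨f j, rfl⟩,
      congr_arg (tropMk n) (funext fun i => le_antisymm ?_ ?_)⟩
    · exact Finset.le_inf' _ _ fun j _ => hf i j
    · exact Finset.inf'_le _ (Finset.mem_univ (I i))

theorem finrank_range_tropMk_comp_selectEval_le (v : Fin (n + 1) → Fin d → ℝ)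
    (I : Fin (n + 1) → Fin (k + 1)) :
    finrank ℝ (LinearMap.range (tropMk n ∘ₗ selectEval v I)) ≤
      min ((k + 1) * (d + 1) - 1) n := by
  refine le_min ?_ ((Submodule.finrank_le _).trans finrank_tropProj.le)
  have h := LinearMap.finrank_range_add_finrank_ker (tropMk n ∘ₗ selectEval v I)
  have hpos : 0 < finrank ℝ (LinearMap.ker (tropMk n ∘ₗ selectEval v I)) := by
    -- Adding 1 to every function shifts the vector by `(1, …, 1)`, which is zero in the quotient;
    -- this is the `- 1` in the bound.
    refine finrank_pos_iff_exists_ne_zero.2 ⟨⟨fun _ => (0, 1), ?_⟩, fun h0 => ?_⟩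
    · rw [LinearMap.mem_ker, LinearMap.comp_apply, ← tropMk_const 1]
      congr 1
      ext i
      simp [selectEval_apply, affineEval_apply]
    · simpa using congr_arg Prod.snd (congr_fun (congr_arg Subtype.val h0) 0)
  rw [finrank_pi_fintype] at h
  simp at h
  omega

end Secant

theorem proposition2p4 (n d k : ℕ) (hd : 1 ≤ d)
    (L : Submodule ℝ (TropProj n)) (hL : Module.finrank ℝ L = d)
    (M : Matrix (Fin d) (Fin (n + 1)) ℝ)
    (hM : Submodule.span ℝ (Set.range fun r => TropProj.mk (M r)) = L)
    (hgen : InGeneralPosition fun i : Fin (n + 1) => M.col i) :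
    (∃ K : PolyhedralComplex (TropProj n), K.support = tropSecant k L) ∧
      ∀ K : PolyhedralComplex (TropProj n), K.support = tropSecant k L →
        K.HasDim (min ((k + 1) * (d + 1) - 1) n) := by
  have hdn : d ≤ n := hL ▸ (Submodule.finrank_le L).trans finrank_tropProj.le
  rw [tropSecant_eq_iUnion hM]
  set v : Fin (n + 1) → Fin d → ℝ := fun i => M.col i
  have hpoly := isPolyhedron_minRegion (κ := Fin (k + 1)) v
  refine ⟨exists_polyhedralComplex_support_eq_iUnion fun I => (hpoly I).image _, fun K hK => ?_⟩
  have hup : ∀ P ∈ K.cells,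
      Module.finrank ℝ (vectorSpan ℝ P) ≤ min ((k + 1) * (d + 1) - 1) n := by
    intro P hP
    -- Any cell, being convex and covered by the ranges, lies in a single range.
    obtain ⟨I, hI⟩ := (K.polyhedron P hP).convex.exists_subset_of_subset_iUnion_affineSubspace
      (K.nonempty P hP) (fun I : Fin (n + 1) → Fin (k + 1) =>
        (LinearMap.range (tropMk n ∘ₗ selectEval v I)).toAffineSubspace) (by
        refine ((Set.subset_sUnion_of_mem hP).trans hK.subset).trans (Set.iUnion_mono fun I => ?_)
        rintro _ ⟨f, -, rfl⟩
        exact ⟨f, rfl⟩)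
    refine le_trans (Submodule.finrank_mono ?_) (finrank_range_tropMk_comp_selectEval_le v I)
    rw [← direction_affineSpan, ← Submodule.toAffineSubspace_direction
      (LinearMap.range (tropMk n ∘ₗ selectEval v I))]
    exact AffineSubspace.direction_le (affineSpan_le.2 hI)
  refine ⟨?_, by rintro _ ⟨P, hP, rfl⟩; exact hup P hP⟩
  obtain ⟨I, hspan, hrank⟩ := hgen.exists_selectEval_finrank_ge (k := k) hd (by omega)
  set C := (tropMk n ∘ₗ selectEval v I) '' minRegion v I
  have hCspan : vectorSpan ℝ C = (LinearMap.range (selectEval v I)).map (tropMk n) := by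
    rw [← LinearMap.range_comp, LinearMap.range_eq_map, ← hspan]
    exact ((tropMk n ∘ₗ selectEval v I).toAffineMap.map_vectorSpan).symm
  have : Finite K.cells := K.finite
  -- Conversely, the large convex piece `C` is covered by the affine spans of the cells, so one cell
  -- has at least its dimension.
  obtain ⟨⟨P, hP⟩, hCP⟩ := ((hpoly I).image (tropMk n ∘ₗ selectEval v I)).convex
    |>.exists_subset_of_subset_iUnion_affineSubspace (Set.Nonempty.image _ ⟨0, by simp [minRegion]⟩)
      (fun P : K.cells => affineSpan ℝ (P : Set (TropProj n))) (by
        intro x hx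
        obtain ⟨P, hP, hxP⟩ := hK.symm.subset (Set.mem_iUnion.2 ⟨I, hx⟩)
        exact Set.mem_iUnion.2 ⟨⟨P, hP⟩, subset_affineSpan ℝ P hxP⟩)
  refine ⟨P, hP, (hup P hP).antisymm' ?_⟩
  have hle : vectorSpan ℝ C ≤ vectorSpan ℝ P := by
    rw [← direction_affineSpan, ← direction_affineSpan ℝ P]
    exact AffineSubspace.direction_le (affineSpan_le.2 hCP)
  have h₁ := Submodule.finrank_mono hle
  -- The quotient costs at most one dimension, turning `min ((k + 1) * (d + 1)) (n + 1)` into the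
  -- claimed value.
  have h₂ := finrank_le_finrank_map_tropMk_add_one (LinearMap.range (selectEval v I))
  rw [hCspan] at h₁
  change min ((k + 1) * (d + 1)) (n + 1) ≤ _ at hrank
  omega
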